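/- Let $n\ge 1$ and let $\Omega\subset\mathbb{R}^n$ be a bounded domain (nonempty, open, connected). Let $\mathrm{C}_0(\Omega)$ be the space of continuous functions on $\overline\Omega$ that vanish on $\partial\Omega$, with the norm $\|u\|_\infty=\max_{\overline\Omega}|u|$, let $\mathrm{Lip}(\overline\Omega)$ be the space of Lipschitz continuous functions on $\overline\Omega$, and let $\mathrm{Lip}_0(\Omega)$ be its subspace of functions that vanish on $\partial\Omega$. Put $\|\nabla u\|_{L^\infty}=\operatorname{ess\,sup}_{\Omega}|\nabla u|$ and $$R^\infty(u)=\frac{J^\infty(u)}{\|u\|_\infty}\quad (u\in\mathrm{C}_0(\Omega)\setminus\{0\}),\qquad J^\infty(u)=\begin{cases}\|\nabla u\|_{L^\infty},&u\in\mathrm{Lip}_0(\Omega),\\+\infty,&\text{otherwise.}\end{cases}$$ For a Borel set $S$ let $\mathcal{P}(S)$ be the set of Borel probability measures on $S$, and for $\mu,\delta\in\mathcal{P}(\overline\Omega)$ let $$W^1(\mu,\delta)=\sup\Big\{\int u\,d\mu-\int u\,d\delta \;:\; u\in\mathrm{Lip}(\overline\Omega),\ \|\nabla u\|_{L^\infty}\le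 1\Big\}\in[0,+\infty].$$ Let $u\in\mathrm{Lip}_0(\Omega)$ be a minimizer of $R^\infty$ over $\mathrm{C}_0(\Omega)\setminus\{0\}$, and let $\nu$ be a nonnegative Borel measure on $\Omega$ with total mass $\nu(\Omega)=1/\|u\|_\infty$ that is concentrated on the set where $|u|$ is maximal, i.e. $\nu\big(\Omega\setminus\{x\in\Omega:|u(x)|=\|u\|_\infty\}\big)=0$. (In particular, $\nu$ may be the first member of any pair $(\nu,\tau)$ of nonnegative measures that has, besides these two properties of $\nu$, the further properties which characterize solutions of the eigenvalue equation $\lambda_\infty\nu u=-\operatorname{div}(\tau\nabla_\tau u)$, $\lambda_\infty=\min R^\infty$.) Then $\mu:=\|u\|_\infty\,\nu$ is a probability measure on $\Omega$, and $$\mu\in\operatorname*{arg\,max}_{\tilde\mu\in\mathcal{P}(\Omega)}\ \inf_{\delta\in\mathcal{P}(\partial\Omega)}W^1(\tilde\mu,\delta).$$ -/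

import Mathlib

open MeasureTheory Set
open scoped ENNReal NNReal

noncomputable section

namespace LInfEigen

/-- Functions that are continuous on the closure of `Ω` and vanish on its boundary. A function on the
closure of `Ω` is represented by a function on the whole space; all the notions below only use its
values on the closure of `Ω`. -/
def C0 {n : ℕ} (Ω : Set (EuclideanSpace ℝ (Fin n))) : Set (EuclideanSpace ℝ (Fin n) → ℝ) :=
  {u | ContinuousOn u (closure Ω) ∧ ∀ x ∈ frontier Ω, u x = 0}

/-- Lipschitz continuous functions on the closure of `Ω`. -/
def Lip {n : ℕ} (Ω : Set (EuclideanSpace ℝ (Fin n))) : Set (EuclideanSpace ℝ (Fin n) → ℝ) :=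
  {u | ∃ K : ℝ≥0, LipschitzOnWith K u (closure Ω)}

/-- Lipschitz continuous functions on the closure of `Ω` that vanish on its boundary. -/
def Lip0 {n : ℕ} (Ω : Set (EuclideanSpace ℝ (Fin n))) : Set (EuclideanSpace ℝ (Fin n) → ℝ) :=
  {u | u ∈ Lip Ω ∧ ∀ x ∈ frontier Ω, u x = 0}

/-- The supremum norm of `u` on `Ω`. -/
def supNorm {n : ℕ} (Ω : Set (EuclideanSpace ℝ (Fin n))) (u : EuclideanSpace ℝ (Fin n) → ℝ) :
    ℝ≥0∞ :=
  ⨆ x ∈ Ω, ‖u x‖ₑ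

/-- The norm of `∇ u` in `L^∞(Ω)`: the essential supremum over `Ω` of the length of the gradient.
(Lipschitz functions are differentiable almost everywhere in the open set `Ω`.) -/
def gradNorm {n : ℕ} (Ω : Set (EuclideanSpace ℝ (Fin n))) (u : EuclideanSpace ℝ (Fin n) → ℝ) :
    ℝ≥0∞ :=
  eLpNorm (gradient u) ∞ (volume.restrict Ω)

open Classical in
/-- The functional `J^∞`: the `L^∞` norm of the gradient on `Lip0 Ω`, and `+∞` elsewhere. -/
def J {n : ℕ} (Ω : Set (EuclideanSpace ℝ (Fin n))) (u : EuclideanSpace ℝ (Fin n) → ℝ) : ℝ≥0∞ :=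
  if u ∈ Lip0 Ω then gradNorm Ω u else ∞

/-- The Rayleigh quotient `R^∞`, to be used for `u` that do not vanish identically on `Ω`. -/
def rayleigh {n : ℕ} (Ω : Set (EuclideanSpace ℝ (Fin n))) (u : EuclideanSpace ℝ (Fin n) → ℝ) :
    ℝ≥0∞ :=
  J Ω u / supNorm Ω u

/-- `u` is a nonzero element of `C0 Ω` that minimizes the Rayleigh quotient among all of them. -/
def IsRayleighMinimizer {n : ℕ} (Ω : Set (EuclideanSpace ℝ (Fin n)))
    (u : EuclideanSpace ℝ (Fin n) → ℝ) : Prop :=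
  (u ∈ C0 Ω ∧ ∃ x ∈ Ω, u x ≠ 0) ∧ IsMinOn (rayleigh Ω) {v | v ∈ C0 Ω ∧ ∃ x ∈ Ω, v x ≠ 0} u

/-- The set of points of `Ω` at which `|u|` attains its maximum. -/
def omegaMax {n : ℕ} (Ω : Set (EuclideanSpace ℝ (Fin n))) (u : EuclideanSpace ℝ (Fin n) → ℝ) :
    Set (EuclideanSpace ℝ (Fin n)) :=
  {x | x ∈ Ω ∧ ‖u x‖ₑ = supNorm Ω u}

/-- Borel probability measures on `S`, regarded as measures on the whole space that are
carried by `S`. -/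
def Prob {n : ℕ} (S : Set (EuclideanSpace ℝ (Fin n))) : Set (Measure (EuclideanSpace ℝ (Fin n))) :=
  {μ | IsProbabilityMeasure μ ∧ μ Sᶜ = 0}

/-- The geodesic `1`-Wasserstein distance of two probability measures on the closure of `Ω`: the
supremum of `∫ u dμ - ∫ u dδ` over all Lipschitz functions `u` on the closure of `Ω` whose
gradient is bounded by `1` almost everywhere in `Ω`. It may be `+∞`, since the geodesic distance
between boundary points of a bounded domain may be infinite. -/
def W1 {n : ℕ} (Ω : Set (EuclideanSpace ℝ (Fin n)))
    (μ δ : Measure (EuclideanSpace ℝ (Fin n))) : EReal :=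
  ⨆ u ∈ {u | u ∈ Lip Ω ∧ gradNorm Ω u ≤ 1}, ((∫ x, u x ∂μ - ∫ x, u x ∂δ : ℝ) : EReal)

/-- The transport distance from `μ` to the boundary of `Ω`: the infimum of the distance
to `δ` over all probability measures `δ` on the boundary. -/
def distToBoundary {n : ℕ} (Ω : Set (EuclideanSpace ℝ (Fin n)))
    (μ : Measure (EuclideanSpace ℝ (Fin n))) : EReal :=
  ⨅ δ ∈ Prob (frontier Ω), W1 Ω μ δ

end LInfEigen

end

/-!
Let `d x = infDist x Ωᶜ` be the distance to the boundary and `r` its maximum over `Ω`. The proof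
shows that `μ` is concentrated on `{d = r}`, and that for every probability measure on `Ω` the
transport distance to the boundary is at most `r`, with equality if the measure is concentrated on
`{d = r}`.

The geometric input is that a function with `|∇w| ≤ C` almost everywhere in `Ω` is `C`-Lipschitz on
every closed ball whose interior lies in `Ω` (`lipschitzOnWith_of_ae_norm_fderiv_le`). Applied to
the ball around `x` of radius `d x`, which touches the boundary, it gives `|w x| ≤ C * d x` for
functions `w` that vanish on the boundary (`norm_le_mul_infDist`). Comparing a minimizer `u` of the
Rayleigh quotient with the competitor `d` gives `‖∇u‖ * r ≤ ‖u‖`; hence `|u x| = ‖u‖` forces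
`d x = r` (`infDist_le_of_mem_omegaMax`).

The upper bound `r` for the transport distance (`distToBoundary_le`) comes from pushing the measure
to the boundary along an approximate nearest-point projection with countably many values. The lower
bound (`le_distToBoundary`) comes from `d` as a Kantorovich potential.
-/

open Metric Filter Topology

/-! ### Lipschitz constants from almost everywhere gradient bounds -/

/-- If the derivative of a Lipschitz function is bounded by `C` almost everywhere on a convex open
set, then `C` is a Lipschitz constant there: by Fubini, almost every translate of a given segment
meets the exceptional null set in a null set, and on such a translate the fundamental theorem of
calculus for absolutely continuous functions applies. -/
theorem lipschitzOnWith_of_ae_norm_fderiv_le {E : Type*} [NormedAddCommGroup E] [NormedSpace ℝ E]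
    [FiniteDimensional ℝ E] [MeasurableSpace E] [BorelSpace E] {μ : Measure E}
    [μ.IsAddHaarMeasure] {f : E → ℝ} {s : Set E} (hso : IsOpen s) (hsc : Convex ℝ s) {K C : ℝ≥0}
    (hf : LipschitzOnWith K f s) (hC : ∀ᵐ x ∂μ, x ∈ s → ‖fderiv ℝ f x‖ ≤ C) :
    LipschitzOnWith C f s := by
  obtain ⟨g, hg, hfg⟩ := hf.extend_real
  have hgC : ∀ᵐ x ∂μ, x ∈ s → DifferentiableAt ℝ g x ∧ ‖fderiv ℝ g x‖ ≤ C := by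
    filter_upwards [hC, hg.ae_differentiableAt (μ := μ)] with x hx hdx hxs
    have h : f =ᶠ[𝓝 x] g := hfg.eventuallyEq_of_mem (hso.mem_nhds hxs)
    exact ⟨hdx, (h.fderiv_eq (𝕜 := ℝ)) ▸ hx hxs⟩
  -- Fubini needs a measurable exceptional set.
  obtain ⟨N, hN, hNm, hN0⟩ := exists_measurable_superset_of_null (ae_iff.1 hgC)
  have hgood : ∀ x ∉ N, x ∈ s → DifferentiableAt ℝ g x ∧ ‖fderiv ℝ g x‖ ≤ C := by
    intro x hx
    by_contra h
    exact hx (hN h)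
  refine LipschitzOnWith.of_dist_le_mul fun x hx y hy => ?_
  set v := y - x with hv
  have hae : ∀ᵐ z ∂μ, ∀ᵐ t : ℝ, z + t • v ∉ N := by
    have hm : MeasurableSet {p : E × ℝ | p.1 + p.2 • v ∉ N} := by
      have : Measurable fun p : E × ℝ => p.1 + p.2 • v :=
        (by fun_prop : Continuous fun p : E × ℝ => p.1 + p.2 • v).measurable
      exact this hNm.compl
    refine (Measure.ae_ae_comm hm).2 (Eventually.of_forall fun t => ?_)
    exact measure_eq_zero_iff_ae_notMem.1 ((measure_preimage_add_right μ (t • v) N).trans hN0)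
  have hseg : ∀ z, z ∈ s → z + v ∈ s → (∀ᵐ t : ℝ, z + t • v ∉ N) →
      dist (g z) (g (z + v)) ≤ C * ‖v‖ := by
    intro z hz hzv ht
    let h : ℝ → ℝ := fun t => g (z + t • v)
    have hline : LipschitzWith ‖v‖₊ fun t : ℝ => z + t • v := by
      refine LipschitzWith.of_dist_le_mul fun a b => ?_
      rw [dist_add_left, dist_eq_norm, ← sub_smul, norm_smul, Real.dist_eq, Real.norm_eq_abs,
        coe_nnnorm, mul_comm]
    have hint := (hg.comp hline).lipschitzOnWith (s := uIcc (0 : ℝ) 1)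
      |>.absolutelyContinuousOnInterval.integral_deriv_eq_sub
    have hbd : ‖∫ t in (0 : ℝ)..1, deriv h t‖ ≤ C * ‖v‖ * |1 - 0| := by
      refine intervalIntegral.norm_integral_le_of_norm_le_const_ae ?_
      filter_upwards [ht] with t htN htI
      rw [uIoc_of_le zero_le_one] at htI
      obtain ⟨hd, hle⟩ := hgood _ htN (hsc.add_smul_mem hz hzv ⟨htI.1.le, htI.2⟩)
      have hl : HasDerivAt (fun t : ℝ => z + t • v) v t := by
        simpa using ((hasDerivAt_id t).smul_const v).const_add z
      have : HasDerivAt h (fderiv ℝ g (z + t • v) v) t := hd.hasFDerivAt.comp_hasDerivAt t hl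
      rw [this.deriv]
      exact (ContinuousLinearMap.le_opNorm _ _).trans (by gcongr)
    rw [dist_comm, dist_eq_norm]
    have e : ∫ t in (0 : ℝ)..1, deriv h t = g (z + v) - g z := by
      simpa [h, Function.comp_def] using hint
    simpa [e] using hbd
  have hU : IsOpen {z | z ∈ s ∧ z + v ∈ s} :=
    hso.inter (hso.preimage (continuous_add_const v))
  have hxU : x ∈ {z | z ∈ s ∧ z + v ∈ s} := ⟨hx, by simpa [hv] using hy⟩
  have hcl : IsClosed {z | dist (g z) (g (z + v)) ≤ C * ‖v‖} :=
    isClosed_le (hg.continuous.dist (hg.continuous.comp (continuous_add_const v)))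
      continuous_const
  have hmem := hcl.closure_subset_iff.2 (fun z hz => hseg z hz.1.1 hz.1.2 hz.2)
    ((Measure.dense_of_ae hae).open_subset_closure_inter hU hxU)
  have hxv : x + v = y := by simp [hv]
  rw [hfg hx, hfg hy, dist_comm x y, dist_eq_norm y x]
  simpa [hxv] using hmem

namespace LInfEigen

variable {n : ℕ} {Ω : Set (EuclideanSpace ℝ (Fin n))}

theorem norm_gradient_eq_norm_fderiv (w : EuclideanSpace ℝ (Fin n) → ℝ)
    (x : EuclideanSpace ℝ (Fin n)) : ‖gradient w x‖ = ‖fderiv ℝ w x‖ := by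
  rw [← toDual_gradient, LinearIsometryEquiv.norm_map]

/-- On a closed ball whose interior lies in `Ω`, the gradient bound is a Lipschitz constant. -/
theorem lipschitzOnWith_closedBall_of_gradNorm_le (hΩo : IsOpen Ω)
    {w : EuclideanSpace ℝ (Fin n) → ℝ} (hw : w ∈ Lip Ω) {C : ℝ≥0} (hC : gradNorm Ω w ≤ C)
    {x : EuclideanSpace ℝ (Fin n)} {r : ℝ} (hr : 0 < r) (hball : ball x r ⊆ Ω) :
    LipschitzOnWith C w (closedBall x r) := by
  obtain ⟨K, hK⟩ := hw
  rw [← closure_ball x hr.ne']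
  refine LipschitzOnWith.closure (hK.continuousOn.mono (closure_mono hball)) ?_
  refine lipschitzOnWith_of_ae_norm_fderiv_le (μ := volume) isOpen_ball (convex_ball x r)
    (hK.mono (hball.trans subset_closure)) ?_
  have h := ae_le_eLpNormEssSup (f := gradient w) (μ := volume.restrict Ω)
  rw [ae_restrict_iff' hΩo.measurableSet] at h
  filter_upwards [h] with y hy hyb
  have := (hy (hball hyb)).trans (eLpNorm_exponent_top.symm.le.trans hC)
  rw [← norm_gradient_eq_norm_fderiv]
  rw [enorm_eq_nnnorm] at this
  exact_mod_cast this

/-! ### The distance to the boundary -/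

theorem compl_nonempty (hn : 1 ≤ n) (hΩb : Bornology.IsBounded Ω) : Ωᶜ.Nonempty := by
  have : Nonempty (Fin n) := ⟨⟨0, hn⟩⟩
  rw [nonempty_compl]
  rintro rfl
  exact NormedSpace.unbounded_univ ℝ (EuclideanSpace ℝ (Fin n)) hΩb

theorem infDist_compl_pos (hΩo : IsOpen Ω) (hne : Ωᶜ.Nonempty) {x : EuclideanSpace ℝ (Fin n)}
    (hx : x ∈ Ω) : 0 < infDist x Ωᶜ :=
  (hΩo.isClosed_compl.notMem_iff_infDist_pos hne).1 (by simpa using hx)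

theorem exists_mem_frontier_dist_eq (hΩo : IsOpen Ω) (hne : Ωᶜ.Nonempty)
    {x : EuclideanSpace ℝ (Fin n)} (hx : x ∈ Ω) :
    ∃ y ∈ frontier Ω, dist x y = infDist x Ωᶜ := by
  obtain ⟨y, hy, hxy⟩ := hΩo.isClosed_compl.exists_infDist_eq_dist hne x
  refine ⟨y, ?_, hxy.symm⟩
  rw [hΩo.frontier_eq]
  refine ⟨closedBall_infDist_compl_subset_closure hx ?_, hy⟩
  rw [mem_closedBall, dist_comm, hxy]

theorem infDist_compl_eq_zero_of_mem_frontier (hΩo : IsOpen Ω) {x : EuclideanSpace ℝ (Fin n)}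
    (hx : x ∈ frontier Ω) : infDist x Ωᶜ = 0 := by
  rw [hΩo.frontier_eq] at hx
  exact infDist_zero_of_mem hx.2

/-- A Lipschitz function vanishing on the boundary is dominated by the distance to the
boundary. -/
theorem norm_le_mul_infDist (hΩo : IsOpen Ω) (hne : Ωᶜ.Nonempty)
    {w : EuclideanSpace ℝ (Fin n) → ℝ} (hw : w ∈ Lip0 Ω) {C : ℝ≥0} (hC : gradNorm Ω w ≤ C)
    {x : EuclideanSpace ℝ (Fin n)} (hx : x ∈ Ω) : ‖w x‖ ≤ C * infDist x Ωᶜ := by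
  have hd := infDist_compl_pos hΩo hne hx
  obtain ⟨y, hy, hxy⟩ := exists_mem_frontier_dist_eq hΩo hne hx
  have hL := lipschitzOnWith_closedBall_of_gradNorm_le hΩo hw.1 hC hd ball_infDist_compl_subset
  have := hL.dist_le_mul x (mem_closedBall_self hd.le) y
    (by rw [mem_closedBall, dist_comm, hxy])
  rwa [hw.2 y hy, dist_zero_right, hxy] at this

theorem infDist_compl_mem_Lip0 (hΩo : IsOpen Ω) : (fun x => infDist x Ωᶜ) ∈ Lip0 Ω :=
  ⟨⟨1, (lipschitz_infDist_pt _).lipschitzOnWith⟩,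
    fun _ hx => infDist_compl_eq_zero_of_mem_frontier hΩo hx⟩

theorem gradNorm_infDist_compl_le : gradNorm Ω (fun x => infDist x Ωᶜ) ≤ 1 := by
  unfold gradNorm
  rw [eLpNorm_exponent_top]
  refine eLpNormEssSup_le_of_ae_enorm_bound (Eventually.of_forall fun x => ?_)
  rw [enorm_eq_nnnorm]
  have := norm_fderiv_le_of_lipschitz ℝ (x₀ := x) (lipschitz_infDist_pt Ωᶜ)
  rw [← norm_gradient_eq_norm_fderiv] at this
  exact_mod_cast this

/-! ### Minimizers of the Rayleigh quotient -/

theorem Lip0.mem_C0 {w : EuclideanSpace ℝ (Fin n) → ℝ} (hw : w ∈ Lip0 Ω) : w ∈ C0 Ω :=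
  ⟨hw.1.choose_spec.continuousOn, hw.2⟩

theorem supNorm_ne_zero {w : EuclideanSpace ℝ (Fin n) → ℝ} (hw : ∃ x ∈ Ω, w x ≠ 0) :
    supNorm Ω w ≠ 0 := by
  obtain ⟨x, hx, hwx⟩ := hw
  have : ‖w x‖ₑ ≤ supNorm Ω w := le_iSup₂_of_le x hx le_rfl
  exact ((pos_iff_ne_zero.2 (by simpa using hwx)).trans_le this).ne'

theorem exists_forall_norm_le (hΩb : Bornology.IsBounded Ω)
    {w : EuclideanSpace ℝ (Fin n) → ℝ} (hw : ContinuousOn w (closure Ω)) :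
    ∃ M : ℝ≥0, ∀ x ∈ closure Ω, ‖w x‖ ≤ M := by
  obtain ⟨M, hM⟩ := hΩb.isCompact_closure.exists_bound_of_continuousOn hw
  exact ⟨M.toNNReal, fun x hx => (hM x hx).trans (Real.le_coe_toNNReal M)⟩

theorem supNorm_ne_top (hΩb : Bornology.IsBounded Ω)
    {w : EuclideanSpace ℝ (Fin n) → ℝ} (hw : ContinuousOn w (closure Ω)) :
    supNorm Ω w ≠ ∞ := by
  obtain ⟨M, hM⟩ := exists_forall_norm_le hΩb hw
  refine ne_top_of_le_ne_top (ENNReal.coe_ne_top (r := M)) (iSup₂_le fun x hx => ?_)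
  rw [enorm_eq_nnnorm]
  exact_mod_cast hM x (subset_closure hx)

/-- A minimizer of the Rayleigh quotient attains its maximal modulus only at points of maximal
distance to the boundary. -/
theorem infDist_le_of_mem_omegaMax (hΩo : IsOpen Ω) (hΩb : Bornology.IsBounded Ω)
    (hne : Ωᶜ.Nonempty) {u : EuclideanSpace ℝ (Fin n) → ℝ} (hu : u ∈ Lip0 Ω)
    (humin : IsRayleighMinimizer Ω u) {x y : EuclideanSpace ℝ (Fin n)} (hx : x ∈ omegaMax Ω u)
    (hy : y ∈ Ω) : infDist y Ωᶜ ≤ infDist x Ωᶜ := by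
  set d : EuclideanSpace ℝ (Fin n) → ℝ := fun x => infDist x Ωᶜ with hd
  have hdL : d ∈ Lip0 Ω := infDist_compl_mem_Lip0 hΩo
  have hdne : ∃ x ∈ Ω, d x ≠ 0 := ⟨y, hy, (infDist_compl_pos hΩo hne hy).ne'⟩
  have hS0 := supNorm_ne_zero humin.1.2
  have hST := supNorm_ne_top hΩb humin.1.1.1
  have hD0 := supNorm_ne_zero hdne
  have hDT := supNorm_ne_top hΩb (Lip0.mem_C0 hdL).1
  have hle : gradNorm Ω u / supNorm Ω u ≤ 1 / supNorm Ω d := by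
    have h : rayleigh Ω u ≤ rayleigh Ω d := humin.2 ⟨Lip0.mem_C0 hdL, hdne⟩
    simp only [rayleigh, J, if_pos hu, if_pos hdL] at h
    exact h.trans (by gcongr; exact gradNorm_infDist_compl_le)
  have hGD : gradNorm Ω u * supNorm Ω d ≤ supNorm Ω u := by
    rw [ENNReal.div_le_iff hS0 hST, ← ENNReal.mul_div_right_comm, one_mul] at hle
    exact (ENNReal.le_div_iff_mul_le (Or.inl hD0) (Or.inl hDT)).1 hle
  have hGT : gradNorm Ω u ≠ ∞ := by
    intro h
    rw [h, ENNReal.top_mul hD0, top_le_iff] at hGD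
    exact hST hGD
  lift gradNorm Ω u to ℝ≥0 using hGT with G hG
  have hSx : supNorm Ω u ≤ G * ‖d x‖ₑ := by
    rw [← hx.2]
    have := norm_le_mul_infDist hΩo hne hu hG.symm.le hx.1
    have h2 : ‖u x‖₊ ≤ G * ‖d x‖₊ := by
      rw [← NNReal.coe_le_coe]
      push_cast
      rw [Real.norm_of_nonneg (r := d x) infDist_nonneg]
      exact this
    simp only [enorm_eq_nnnorm]
    exact_mod_cast h2
  have hG0 : (G : ℝ≥0∞) ≠ 0 := by
    intro h
    rw [h, zero_mul] at hSx
    exact hS0 (le_zero_iff.1 hSx)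
  have h1 : ‖d y‖ₑ ≤ supNorm Ω d := le_iSup₂_of_le y hy le_rfl
  have h2 : (G : ℝ≥0∞) * ‖d y‖ₑ ≤ G * ‖d x‖ₑ :=
    (mul_le_mul_right h1 _).trans (hGD.trans hSx)
  have h3 := (ENNReal.mul_le_mul_iff_right hG0 ENNReal.coe_ne_top).1 h2
  rw [Real.enorm_eq_ofReal infDist_nonneg, Real.enorm_eq_ofReal infDist_nonneg] at h3
  exact (ENNReal.ofReal_le_ofReal_iff infDist_nonneg).1 h3

/-! ### The transport distance to the boundary -/

theorem Prob.ae_mem {S : Set (EuclideanSpace ℝ (Fin n))}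
    {μ : Measure (EuclideanSpace ℝ (Fin n))} (hμ : μ ∈ Prob S) : ∀ᵐ x ∂μ, x ∈ S :=
  ae_iff.2 hμ.2

theorem aestronglyMeasurable_of_mem_Lip {μ : Measure (EuclideanSpace ℝ (Fin n))}
    (hμ : ∀ᵐ x ∂μ, x ∈ closure Ω) {w : EuclideanSpace ℝ (Fin n) → ℝ} (hw : w ∈ Lip Ω) :
    AEStronglyMeasurable w μ := by
  have h := hw.choose_spec.continuousOn.aestronglyMeasurable (μ := μ)
    isClosed_closure.measurableSet
  rwa [Measure.restrict_eq_self_of_ae_mem hμ] at h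

theorem integrable_of_mem_Lip (hΩb : Bornology.IsBounded Ω)
    {μ : Measure (EuclideanSpace ℝ (Fin n))} [IsFiniteMeasure μ]
    (hμ : ∀ᵐ x ∂μ, x ∈ closure Ω) {w : EuclideanSpace ℝ (Fin n) → ℝ} (hw : w ∈ Lip Ω) :
    Integrable w μ := by
  obtain ⟨M, hM⟩ := exists_forall_norm_le hΩb hw.choose_spec.continuousOn
  exact Integrable.of_bound (aestronglyMeasurable_of_mem_Lip hμ hw) M (hμ.mono hM)

/-- An approximate measurable nearest-point projection onto the boundary. It takes countably many
values, which spares a measurable selection theorem: a point `x` is sent to a nearest boundary point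
of a nearby point `z` of a dense sequence, so that `x` and its image lie in a common closed ball
with interior in `Ω`. -/
theorem exists_measurable_approx_projection (hΩo : IsOpen Ω) (hΩne : Ω.Nonempty)
    (hne : Ωᶜ.Nonempty) {ε : ℝ} (hε : 0 < ε) :
    ∃ T : EuclideanSpace ℝ (Fin n) → EuclideanSpace ℝ (Fin n), Measurable T ∧
      (∀ x, T x ∈ frontier Ω) ∧ ∀ x ∈ Ω, ∃ z ∈ Ω, dist x z < ε ∧
        x ∈ closedBall z (infDist z Ωᶜ) ∧ dist z (T x) = infDist z Ωᶜ := by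
  classical
  have : Nonempty Ω := hΩne.to_subtype
  let z : ℕ → Ω := TopologicalSpace.denseSeq Ω
  choose P hPf hPd using fun z : Ω => exists_mem_frontier_dist_eq hΩo hne z.2
  let p : ℕ → EuclideanSpace ℝ (Fin n) → Prop :=
    fun k x => (dist x (z k) < ε ∧ dist x (z k) < infDist (z k : EuclideanSpace ℝ (Fin n)) Ωᶜ)
      ∨ x ∉ Ω
  have hp : ∀ x, ∃ k, p k x := by
    intro x
    by_cases hx : x ∈ Ω
    · have hd := infDist_compl_pos hΩo hne hx
      obtain ⟨k, hk⟩ := (TopologicalSpace.denseRange_denseSeq Ω).exists_dist_lt ⟨x, hx⟩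
        (ε := min ε (infDist x Ωᶜ / 2)) (by positivity)
      change dist x (z k) < _ at hk
      refine ⟨k, Or.inl ⟨hk.trans_le (min_le_left _ _), ?_⟩⟩
      have h1 := hk.trans_le (min_le_right _ _)
      have h2 := infDist_le_infDist_add_dist (s := Ωᶜ) (x := x)
        (y := (z k : EuclideanSpace ℝ (Fin n)))
      linarith
    · exact ⟨0, Or.inr hx⟩
  have hm : ∀ k, MeasurableSet {x | p k x} := by
    intro k
    have h1 : IsOpen {x : EuclideanSpace ℝ (Fin n) | dist x (z k) < ε ∧
        dist x (z k) < infDist (z k : EuclideanSpace ℝ (Fin n)) Ωᶜ} :=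
      isOpen_ball.inter isOpen_ball
    exact h1.measurableSet.union hΩo.measurableSet.compl
  refine ⟨fun x => P (z (Nat.find (hp x))),
    Measurable.find (f := fun k _ => P (z k)) (fun _ => measurable_const) hm hp,
    fun x => hPf _, fun x hx => ?_⟩
  obtain ⟨h1, h2⟩ := (Nat.find_spec (hp x)).resolve_right (not_not.2 hx)
  exact ⟨z (Nat.find (hp x)), (z (Nat.find (hp x))).2, h1, h2.le, hPd _⟩

/-- Transporting a measure along approximate nearest-point projections costs at most the inradius,
up to an arbitrarily small error. -/
theorem distToBoundary_le (hΩo : IsOpen Ω) (hΩne : Ω.Nonempty) (hΩb : Bornology.IsBounded Ω)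
    (hne : Ωᶜ.Nonempty) {r : ℝ} (hr : ∀ x ∈ Ω, infDist x Ωᶜ ≤ r)
    {μ : Measure (EuclideanSpace ℝ (Fin n))} (hμ : μ ∈ Prob Ω) :
    distToBoundary Ω μ ≤ (r : EReal) := by
  have := hμ.1
  refine EReal.le_of_forall_lt_iff_le.1 fun s hs => ?_
  have hε : 0 < s - r := sub_pos.2 (EReal.coe_lt_coe_iff.1 hs)
  obtain ⟨T, hTm, hTf, hT⟩ := exists_measurable_approx_projection hΩo hΩne hne hε
  have : IsProbabilityMeasure (μ.map T) := Measure.isProbabilityMeasure_map hTm.aemeasurable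
  have hδ : μ.map T ∈ Prob (frontier Ω) := by
    refine ⟨inferInstance, ?_⟩
    rw [Measure.map_apply hTm isClosed_frontier.measurableSet.compl]
    exact measure_mono_null (fun x hx => hx (hTf x)) measure_empty
  refine (iInf₂_le (μ.map T) hδ).trans (iSup₂_le fun w hw => EReal.coe_le_coe_iff.2 ?_)
  have hμc : ∀ᵐ x ∂μ, x ∈ closure Ω := (Prob.ae_mem hμ).mono fun _ h => subset_closure h
  have hδc : ∀ᵐ x ∂(μ.map T), x ∈ closure Ω :=
    (Prob.ae_mem hδ).mono fun _ h => frontier_subset_closure h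
  have hwδ := integrable_of_mem_Lip hΩb hδc hw.1
  have hwμ := integrable_of_mem_Lip hΩb hμc hw.1
  have hwT : Integrable (fun x => w (T x)) μ := hwδ.comp_measurable hTm
  rw [integral_map hTm.aemeasurable hwδ.aestronglyMeasurable, ← integral_sub hwμ hwT]
  have hpt : ∀ᵐ x ∂μ, w x - w (T x) ≤ s := by
    filter_upwards [Prob.ae_mem hμ] with x hx
    obtain ⟨z, hz, hxz, hxb, hzT⟩ := hT x hx
    have hL := lipschitzOnWith_closedBall_of_gradNorm_le (C := 1) hΩo hw.1 (by simpa using hw.2)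
      (infDist_compl_pos hΩo hne hz) ball_infDist_compl_subset
    have h1 := hL.dist_le_mul x hxb (T x) (by rw [mem_closedBall, dist_comm, hzT])
    have h2 := dist_triangle x z (T x)
    have h3 := hr z hz
    have h4 := le_abs_self (w x - w (T x))
    rw [Real.dist_eq, NNReal.coe_one, one_mul] at h1
    linarith
  simpa using integral_mono_ae (hwμ.sub hwT) (integrable_const s) hpt

/-- The distance to the boundary, used as a Kantorovich potential, bounds the transport distance
from below. -/
theorem le_distToBoundary (hΩo : IsOpen Ω) (hΩb : Bornology.IsBounded Ω) {r : ℝ}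
    {μ : Measure (EuclideanSpace ℝ (Fin n))} (hμ : μ ∈ Prob Ω)
    (hr : ∀ᵐ x ∂μ, r ≤ infDist x Ωᶜ) : (r : EReal) ≤ distToBoundary Ω μ := by
  have := hμ.1
  have hd := infDist_compl_mem_Lip0 hΩo
  refine le_iInf₂ fun δ hδ => le_iSup₂_of_le (fun x => infDist x Ωᶜ)
    ⟨hd.1, gradNorm_infDist_compl_le⟩ (EReal.coe_le_coe_iff.2 ?_)
  have h0 : ∫ x, infDist x Ωᶜ ∂δ = 0 :=
    integral_eq_zero_of_ae ((Prob.ae_mem hδ).mono fun x hx => hd.2 x hx)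
  rw [h0, sub_zero]
  have hi := integrable_of_mem_Lip hΩb
    ((Prob.ae_mem hμ).mono fun _ h => subset_closure h) hd.1
  simpa using integral_mono_ae (integrable_const r) hi hr

end LInfEigen

theorem proposition4p5 {n : ℕ} (hn : 1 ≤ n) (Ω : Set (EuclideanSpace ℝ (Fin n)))
    (hΩo : IsOpen Ω) (hΩc : IsConnected Ω) (hΩb : Bornology.IsBounded Ω)
    (u : EuclideanSpace ℝ (Fin n) → ℝ) (hu : u ∈ LInfEigen.Lip0 Ω)
    (humin : LInfEigen.IsRayleighMinimizer Ω u)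
    (ν : MeasureTheory.Measure (EuclideanSpace ℝ (Fin n))) (hν : ν Ωᶜ = 0)
    (hνmass : ν Ω = (LInfEigen.supNorm Ω u)⁻¹)
    (hνconc : ν (Ω \ LInfEigen.omegaMax Ω u) = 0) :
    LInfEigen.supNorm Ω u • ν ∈ LInfEigen.Prob Ω ∧
      IsMaxOn (LInfEigen.distToBoundary Ω) (LInfEigen.Prob Ω) (LInfEigen.supNorm Ω u • ν) := by
  have hne := LInfEigen.compl_nonempty hn hΩb
  have hS0 := LInfEigen.supNorm_ne_zero humin.1.2
  have hST := LInfEigen.supNorm_ne_top hΩb humin.1.1.1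
  have huniv : ν univ = (LInfEigen.supNorm Ω u)⁻¹ := by
    rw [← hνmass]
    exact (measure_eq_measure_of_null_sdiff (subset_univ Ω) (by rwa [← compl_eq_univ_sdiff])).symm
  have hprob : LInfEigen.supNorm Ω u • ν ∈ LInfEigen.Prob Ω := by
    refine ⟨⟨?_⟩, ?_⟩
    · rw [Measure.smul_apply, huniv, smul_eq_mul, ENNReal.mul_inv_cancel hS0 hST]
    · rw [Measure.smul_apply, hν, smul_zero]
  refine ⟨hprob, fun μ hμ => ?_⟩
  have hae : ∀ᵐ x ∂ν, x ∈ LInfEigen.omegaMax Ω u := by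
    filter_upwards [ae_iff.2 hν, measure_eq_zero_iff_ae_notMem.1 hνconc] with x hx hx'
    by_contra h
    exact hx' ⟨hx, h⟩
  have : NeZero ν := ⟨fun h => by
    rw [h, Measure.coe_zero, Pi.zero_apply, eq_comm, ENNReal.inv_eq_zero] at huniv
    exact hST huniv⟩
  obtain ⟨x₀, hx₀⟩ := hae.exists
  -- The inradius of `Ω` is `infDist x₀ Ωᶜ`.
  have hmax : ∀ x ∈ LInfEigen.omegaMax Ω u, ∀ y ∈ Ω, infDist y Ωᶜ ≤ infDist x Ωᶜ :=
    fun x hx y hy => LInfEigen.infDist_le_of_mem_omegaMax hΩo hΩb hne hu humin hx hy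
  refine (LInfEigen.distToBoundary_le hΩo hΩc.nonempty hΩb hne (hmax x₀ hx₀) hμ).trans
    (LInfEigen.le_distToBoundary hΩo hΩb hprob ?_)
  exact (Measure.ae_smul_measure hae _).mono fun x hx => hmax x hx x₀ hx₀.1
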